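/- Let $\Gamma=(V,E)$ be a finite digraph without loops on at least two vertices, with real edge weights $\omega(u,v)\ge 0$ and $\omega(u,v)=0$ for $(u,v)\notin E$, which is strongly connected, meaning that any vertex can be reached from any other along edges of positive weight. Let $d_u=\sum_v\omega(u,v)$ be the out-degree of $u$, let $D=\mathrm{Diag}[d_u]$, $A=(\omega(u,v))_{u,v}$ and $P=D^{-1}A$, let $\pi$ be the stationary distribution (the unique positive probability vector with $\pi^{*}P=\pi^{*}$), and let $\Pi=\mathrm{Diag}[\pi_u]$. Let $\mathcal G$ be the normalized Green's function of $\Gamma$, that is, the Moore-Penrose pseudoinverse of the normalized Laplacian $\mathcal L=\Pi^{1/2}(I-P)\Pi^{-1/2}$. A rooted $k$-forest is a digraph whose underlying undirected graph has no cycles (a pair of antiparallel edges counting as a cycle) and exactly $k$ connected components, and in which each component $T$ has a vertex $r(T)$, its root, to which every vertex of $T$ has a unique directed path. Let $\mathbb F_k^*$ be the set of rooted $k$-forests that are subdigraphs of $\Gamma$ containing all vertices of $\Gamma$, let $\omega(F)=\prod_{e\in E(F)}\omega(e)$ for $F \in \mathbb F_k^*$, and let $\tau_w=\sum_{T\in\mathbb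 F_1^*,\ r(T)=w}\omega(T)$. Then $$\mathrm{Tr}(\mathcal G)=\frac{1}{\sum_{w\in V} d_w\tau_w}\sum_{T_1\cup T_2\in\mathbb F_2^*} d_{r(T_1)}\,d_{r(T_2)}\,\omega(T_1\cup T_2),$$ where $T_1,T_2$ are the two components of a member of $\mathbb F_2^*$ and each forest is counted once, regardless of the order of $T_1$ and $T_2$. -/

import Mathlib

/-! ### The Moore-Penrose pseudoinverse of a real square matrix -/

section MoorePenrose

variable {n : Type*} [Fintype n]

/-- `X` satisfies the four Penrose equations for the real matrix `M`. -/
structure IsMoorePenroseInverse (M X : Matrix n n ℝ) : Prop where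
  mul_mul_self : M * X * M = M
  mul_mul_inv : X * M * X = X
  symm_left : (M * X).transpose = M * X
  symm_right : (X * M).transpose = X * M

theorem IsMoorePenroseInverse.unique {M X Y : Matrix n n ℝ}
    (hX : IsMoorePenroseInverse M X) (hY : IsMoorePenroseInverse M Y) : X = Y := by
  have h1 : M * X = M * Y := by
    calc M * X = (M * X).transpose := hX.symm_left.symm
      _ = ((M * Y) * (M * X)).transpose := by
          rw [← Matrix.mul_assoc, hY.mul_mul_self]
      _ = (M * X) * (M * Y) := by
          rw [Matrix.transpose_mul, hX.symm_left, hY.symm_left]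
      _ = M * Y := by rw [← Matrix.mul_assoc, hX.mul_mul_self]
  have h2 : X * M = Y * M := by
    calc X * M = (X * M).transpose := hX.symm_right.symm
      _ = ((X * M) * (Y * M)).transpose := by
          rw [Matrix.mul_assoc, ← Matrix.mul_assoc M Y M, hY.mul_mul_self]
      _ = (Y * M) * (X * M) := by
          rw [Matrix.transpose_mul, hX.symm_right, hY.symm_right]
      _ = Y * M := by rw [Matrix.mul_assoc, ← Matrix.mul_assoc M X M, hX.mul_mul_self]
  calc X = X * M * X := hX.mul_mul_inv.symm
    _ = Y * M * X := by rw [h2]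
    _ = Y * (M * Y) := by rw [Matrix.mul_assoc, h1]
    _ = Y := by rw [← Matrix.mul_assoc, hY.mul_mul_inv]

theorem exists_isMoorePenroseInverse [DecidableEq n] (M : Matrix n n ℝ) :
    ∃ X, IsMoorePenroseInverse M X := by
  -- Diagonalize the Gram matrix `H = MᵀM`, invert its nonzero eigenvalues to get `N`,
  -- and take `X = N Mᵀ`.
  have hH : (M.transpose * M).IsHermitian := by
    simpa using Matrix.isHermitian_conjTranspose_mul_self M
  obtain ⟨U, e, hU, hspec⟩ : ∃ (U : Matrix n n ℝ) (e : n → ℝ), U.transpose * U = 1 ∧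
      M.transpose * M = U * Matrix.diagonal e * U.transpose := by
    refine ⟨hH.eigenvectorUnitary, hH.eigenvalues, ?_, ?_⟩
    · have := Unitary.coe_star_mul_self hH.eigenvectorUnitary
      simpa [Matrix.star_eq_conjTranspose] using this
    · have := hH.spectral_theorem
      rw [Unitary.conjStarAlgAut_apply] at this
      simpa [Matrix.star_eq_conjTranspose, Function.comp_def] using this
  have hmul : ∀ a b : n → ℝ, (U * Matrix.diagonal a * U.transpose) *
      (U * Matrix.diagonal b * U.transpose) = U * Matrix.diagonal (fun i => a i * b i) *
        U.transpose := by
    intro a b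
    calc _ = U * Matrix.diagonal a * (U.transpose * U) * Matrix.diagonal b * U.transpose := by
          simp only [Matrix.mul_assoc]
      _ = _ := by rw [hU, Matrix.mul_one, Matrix.mul_assoc U, Matrix.diagonal_mul_diagonal]
  have htr : ∀ a : n → ℝ, (U * Matrix.diagonal a * U.transpose).transpose =
      U * Matrix.diagonal a * U.transpose := by
    intro a
    simp [Matrix.transpose_mul, Matrix.mul_assoc]
  set H := M.transpose * M with hHdef
  set N := U * Matrix.diagonal (fun i => (e i)⁻¹) * U.transpose with hN
  have hNt : N.transpose = N := htr _
  have hHt : H.transpose = H := by rw [hspec]; exact htr _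
  have hNHN : N * H * N = N := by
    rw [hN, hspec, hmul, hmul]
    congr 3; funext i
    by_cases h : e i = 0 <;> simp [h]
  have hHNH : H * N * H = H := by
    rw [hN, hspec, hmul, hmul]
    congr 3; funext i
    by_cases h : e i = 0 <;> simp [h]
  have hcomm : N * H = H * N := by
    rw [hN, hspec, hmul, hmul]
    congr 3; funext i; ring
  have hMNH : M * (N * H) = M := by
    have hz : (M * (N * H) - M).conjTranspose * (M * (N * H) - M) = 0 := by
      have h0 : M.transpose * (M * (N * H) - M) = 0 := by
        rw [Matrix.mul_sub, ← Matrix.mul_assoc, ← hHdef, ← Matrix.mul_assoc, hHNH, sub_self]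
      have ht : (M * (N * H) - M).conjTranspose = (H * N - 1) * M.transpose := by
        rw [Matrix.conjTranspose_eq_transpose_of_trivial, Matrix.transpose_sub,
          Matrix.transpose_mul, Matrix.transpose_mul, hHt, hNt, Matrix.sub_mul, Matrix.one_mul]
      rw [ht, Matrix.mul_assoc, h0, Matrix.mul_zero]
    exact sub_eq_zero.mp (Matrix.conjTranspose_mul_self_eq_zero.mp hz)
  refine ⟨N * M.transpose, ?_, ?_, ?_, ?_⟩
  · rw [Matrix.mul_assoc, Matrix.mul_assoc N, ← hHdef, hMNH]
  · rw [Matrix.mul_assoc N, ← hHdef, ← Matrix.mul_assoc, hNHN]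
  · rw [Matrix.transpose_mul, Matrix.transpose_mul, Matrix.transpose_transpose, hNt,
      Matrix.mul_assoc]
  · rw [Matrix.mul_assoc, ← hHdef, Matrix.transpose_mul, hHt, hNt, hcomm]

/-- The Moore-Penrose pseudoinverse `M⁺` of a real square matrix. -/
noncomputable def moorePenrose [DecidableEq n] (M : Matrix n n ℝ) : Matrix n n ℝ :=
  (exists_isMoorePenroseInverse M).choose

end MoorePenrose

/-! ### Spanning rooted forests, given by their sets of directed edges -/

section Forests

variable {V : Type*}

/-- The underlying undirected graph on all of `V` of a set `F` of directed edges. -/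
def underlyingGraph (F : Finset (V × V)) : SimpleGraph V :=
  SimpleGraph.fromRel (fun u v => (u, v) ∈ F)

/-- `r` is a root of its (weakly) connected component: every vertex of that component has a
unique path to `r` that follows the directions of the edges. -/
def IsRoot (F : Finset (V × V)) (r : V) : Prop :=
  ∀ u, (underlyingGraph F).Reachable u r →
    ∃! p : (underlyingGraph F).Path u r, ∀ d ∈ p.1.darts, (d.fst, d.snd) ∈ F

/-- `F` is the edge set of a spanning rooted `k`-forest on `V`: the underlying undirected graph
has no cycles (a pair of antiparallel edges counts as a cycle of length two, a loop as a cycle of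
length one) and `k` connected components, each of which has a root. -/
structure IsRootedForest (k : ℕ) (F : Finset (V × V)) : Prop where
  asymm : ∀ u v, (u, v) ∈ F → (v, u) ∉ F
  acyclic : (underlyingGraph F).IsAcyclic
  card_components : Nat.card (underlyingGraph F).ConnectedComponent = k
  exists_root : ∀ c : (underlyingGraph F).ConnectedComponent, ∃ r ∈ c.supp, IsRoot F r

open Classical in
/-- The set of roots of `F`. In a rooted `k`-forest `T₁ ∪ ⋯ ∪ Tₖ` each component has exactly one
root, so this is `{r(T₁), …, r(Tₖ)}`. -/
noncomputable def roots [Fintype V] (F : Finset (V × V)) : Finset V :=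
  Finset.univ.filter (fun r => IsRoot F r)

end Forests

/-! ### Weighted digraphs -/

/-- A weighted digraph without loops, with non-negative real weights that vanish off the edges. -/
structure WeightedDigraph (V : Type*) extends Digraph V where
  weight : V → V → ℝ
  loopless : ∀ v, ¬ Adj v v
  weight_nonneg : ∀ u v, 0 ≤ weight u v
  weight_eq_zero : ∀ u v, ¬ Adj u v → weight u v = 0

namespace WeightedDigraph

variable {V : Type*} (Γ : WeightedDigraph V)

/-- Any vertex can be reached from any other along edges of positive weight. (When all edges have
positive weight this is strong connectedness of the digraph; edges of weight zero carry no step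
of the random walk and do not count.) -/
def StronglyConnected : Prop :=
  ∀ u v, Relation.ReflTransGen (fun a b => Γ.Adj a b ∧ 0 < Γ.weight a b) u v

variable [Fintype V]

/-- The adjacency matrix `A`. -/
def adjMatrix : Matrix V V ℝ := Matrix.of Γ.weight

/-- The out-degree `d_u`. -/
def deg (u : V) : ℝ := ∑ v, Γ.weight u v

open Classical in
/-- The edge set. -/
noncomputable def edges : Finset (V × V) := Finset.univ.filter (fun e => Γ.Adj e.1 e.2)

/-- The weight `ω(F)` of a sub-digraph: the product of the weights of its edges. -/
def forestWeight (F : Finset (V × V)) : ℝ := ∏ e ∈ F, Γ.weight e.1 e.2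

open Classical in
/-- The family of spanning rooted `k`-forests of `Γ`. -/
noncomputable def rootedForests (k : ℕ) : Finset (Finset (V × V)) :=
  Γ.edges.powerset.filter (fun F => IsRootedForest k F)

open Classical in
/-- `τ_u`: the total weight of the spanning rooted trees with root `u`. -/
noncomputable def treeWeight (u : V) : ℝ :=
  ∑ T ∈ (Γ.rootedForests 1).filter (fun T => IsRoot T u), Γ.forestWeight T

variable [DecidableEq V]

/-- The transition matrix `P = D⁻¹ A` of the random walk. -/
noncomputable def transitionMatrix : Matrix V V ℝ :=
  (Matrix.diagonal Γ.deg)⁻¹ * Γ.adjMatrix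

/-- `p` is a positive probability vector with `p P = p`. -/
structure IsStationary (p : V → ℝ) : Prop where
  pos : ∀ u, 0 < p u
  sum_eq_one : ∑ u, p u = 1
  vecMul_eq : Matrix.vecMul p Γ.transitionMatrix = p

open Classical in
/-- The stationary distribution `π` (unique, and existing on every strongly connected weighted
digraph with at least two vertices; it is `0` if there is none). -/
noncomputable def stationary : V → ℝ :=
  if h : ∃ p, Γ.IsStationary p then h.choose else 0

/-- The normalized Laplacian `Π^{1/2} (I - P) Π^{-1/2}`. -/
noncomputable def normalizedLaplacian : Matrix V V ℝ :=
  Matrix.diagonal (fun u => √(Γ.stationary u)) * (1 - Γ.transitionMatrix) *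
    Matrix.diagonal (fun u => (√(Γ.stationary u))⁻¹)

/-- The normalized Green's function: the Moore-Penrose pseudoinverse of the normalized
Laplacian. -/
noncomputable def normalizedGreen : Matrix V V ℝ := moorePenrose Γ.normalizedLaplacian

end WeightedDigraph

/-! Let `L` be the normalized Laplacian and `p(X) = det(X + L)`. The unit vector `q = √π` spans both
the left and the right kernel of `L`, so the pseudoinverse inverts `L` on the complement of `q`. Its
trace is the sum of the reciprocals of the nonzero eigenvalues, which is `p₂ / p₁`, a ratio of
coefficients of `p` (`trace_moorePenrose`).

As `L` is conjugate to `I - P`, also `p(X) = det(X + I - P)`. Row `u` of this matrix is `X eᵤ + ∑ᵥ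
P(u,v) (eᵤ - eᵥ)`. Expanding by multilinearity, each vertex either stops or picks one successor,
which is a partial map `V → Option V`. A map with an infinite orbit contributes zero, and any other
contributes its weight times `X` to the number of stopping points (`det_smul_one_add_laplacian`).
The surviving maps are exactly the rooted forests, with the stopping points as roots
(`sum_isRootedForest`).

Multiplying by `∏ d_u` turns `P(u,v)` into `ω(u,v)` at non-roots and leaves `d_r` at each root. So
`p₂` and `p₁` become the sums over 2-forests and over trees (`coeff_det_X_add`). -/

open Matrix Finset

universe u

/-! ### Determinants of partial maps and the matrix forest theorem -/

section PartialMaps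

variable {V : Type u}

/-- A partial map terminates if no orbit of it is infinite. -/
def Terminates (f : V → Option V) : Prop := WellFounded fun v u => f u = some v

/-- The row indexed by `u` of the matrix of a partial map: `t eᵤ` if `u` has no image, and
`eᵤ - eᵥ` if its image is `v`. -/
def partialMapRow [DecidableEq V] {R : Type*} [CommRing R] (t : R) (u : V) : Option V → V → R
  | none => Pi.single u t
  | some v => Pi.single u 1 - Pi.single v 1

variable [Fintype V] [DecidableEq V] {R : Type*} [CommRing R]

/-- Ordering the vertices by rank makes the matrix triangular, with diagonal entry `t` at points
without image and 1 elsewhere. -/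
theorem det_partialMapRow_of_terminates (t : R) {f : V → Option V} (hf : Terminates f) :
    (Matrix.of fun u => partialMapRow t u (f u)).det = t ^ #{u | f u = none} := by
  have hwf : IsWellFounded V fun v u => f u = some v := ⟨hf⟩
  -- Rank drops along arrows, whereas `BlockTriangular` wants zeros where the index drops; hence the
  -- order dual.
  let h : V → Ordinal.{u}ᵒᵈ := fun u => OrderDual.toDual (IsWellFounded.rank (fun v u => f u = some v) u)
  have hlt : ∀ u v, f u = some v → h u < h v := fun u v huv =>
    IsWellFounded.rank_lt_of_rel (r := fun v u => f u = some v) huv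
  have hoff : ∀ u v, u ≠ v → ¬ h u < h v → (Matrix.of fun u => partialMapRow t u (f u)) u v = 0 := by
    intro u v huv hle
    rw [Matrix.of_apply]
    rcases hfu : f u with _ | w
    · simp [partialMapRow, huv.symm]
    · have : v ≠ w := by rintro rfl; exact hle (hlt u v hfu)
      simp [partialMapRow, huv.symm, this]
  have htri : (Matrix.of fun u => partialMapRow t u (f u)).BlockTriangular h := by
    intro u v huv
    exact hoff u v (by rintro rfl; exact lt_irrefl _ huv) huv.not_gt
  have hblock : ∀ a, (Matrix.of fun u => partialMapRow t u (f u)).toSquareBlock h a =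
      Matrix.diagonal fun u : {u // h u = a} => if f u = none then t else 1 := by
    intro a
    ext u v
    rcases eq_or_ne u v with rfl | huv
    · rw [Matrix.diagonal_apply_eq, Matrix.toSquareBlock_def, Matrix.of_apply, Matrix.of_apply]
      rcases hfu : f u with _ | w
      · simp [partialMapRow]
      · have : (u : V) ≠ w := by rintro rfl; exact lt_irrefl _ (hlt _ _ hfu)
        simp [partialMapRow, this]
    · rw [Matrix.diagonal_apply_ne _ huv]
      exact hoff u v (fun h => huv (Subtype.ext h)) (by rw [u.2, v.2]; exact lt_irrefl _)
  rw [htri.det]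
  simp_rw [hblock, Matrix.det_diagonal]
  have hfib : ∀ a, ∏ u : {u // h u = a}, (if f u = none then t else 1) =
      ∏ u with h u = a, if f u = none then t else 1 := by
    intro a
    exact (Finset.prod_subtype _ (by simp) fun u => if f u = none then t else 1).symm
  simp_rw [hfib]
  rw [Finset.prod_fiberwise_of_maps_to (fun u _ => Finset.mem_image_of_mem h (Finset.mem_univ u)),
    Finset.prod_ite]
  simp

theorem det_partialMapRow_of_not_terminates [IsDomain R] (t : R) {f : V → Option V}
    (hf : ¬ Terminates f) : (Matrix.of fun u => partialMapRow t u (f u)).det = 0 := by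
  classical
  rw [← Matrix.exists_mulVec_eq_zero_iff]
  have hacc : ∀ u v, f u = some v →
      (Acc (fun v u => f u = some v) u ↔ Acc (fun v u => f u = some v) v) := by
    intro u v huv
    refine ⟨fun h => h.inv huv, fun h => ⟨_, fun w hw => ?_⟩⟩
    obtain rfl : v = w := Option.some_injective _ (huv.symm.trans hw)
    exact h
  -- A kernel vector is the indicator of the points with infinite orbit: it is constant along arrows
  -- and vanishes at points without image.
  refine ⟨fun u => if Acc (fun v u => f u = some v) u then 0 else 1, ?_, ?_⟩
  · intro h0
    refine hf ⟨fun u => ?_⟩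
    by_contra hu
    simpa [hu] using congrFun h0 u
  · funext u
    rw [Matrix.mulVec, Pi.zero_apply]
    change partialMapRow t u (f u) ⬝ᵥ _ = 0
    rcases hfu : f u with _ | v
    · have : Acc (fun v u => f u = some v) u := ⟨_, fun w hw => by simp [hfu] at hw⟩
      simp [partialMapRow, this]
    · simp [partialMapRow, sub_dotProduct, hacc u v hfu]

open Classical in
/-- **Matrix forest theorem**, in terms of partial maps. -/
theorem det_smul_one_add_laplacian [IsDomain R] (t : R) (W : Matrix V V R) :
    (t • 1 + (Matrix.diagonal (fun u => ∑ v, W u v) - W)).det =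
      ∑ f : V → Option V with Terminates f,
        (∏ u, (f u).elim 1 (W u)) * t ^ #{u | f u = none} := by
  -- Each row is a sum over the possible images of `u`, with coefficient 1 for `none`, so
  -- multilinearity gives a sum over partial maps.
  have hrow : t • 1 + (Matrix.diagonal (fun u => ∑ v, W u v) - W) =
      Matrix.of fun u => ∑ o : Option V, o.elim 1 (W u) • partialMapRow t u o := by
    ext u v
    rw [Matrix.of_apply, Fintype.sum_option]
    simp only [partialMapRow, Option.elim, smul_sub, Finset.sum_sub_distrib, one_smul,
      Pi.add_apply, Pi.sub_apply, Finset.sum_apply, Pi.smul_apply, smul_eq_mul, Matrix.add_apply,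
      Matrix.sub_apply, Matrix.smul_apply, ← Finset.sum_mul]
    simp [Matrix.one_apply, Matrix.diagonal_apply, Pi.single_apply, eq_comm]
  rw [hrow]
  change Matrix.detRowAlternating.toMultilinearMap
    (fun u => ∑ o : Option V, o.elim 1 (W u) • partialMapRow t u o) = _
  rw [MultilinearMap.map_sum, Finset.sum_filter]
  refine Finset.sum_congr rfl fun f _ => ?_
  rw [MultilinearMap.map_smul_univ, smul_eq_mul]
  change _ * (Matrix.of fun u => partialMapRow t u (f u)).det = _
  split_ifs with hf
  · rw [det_partialMapRow_of_terminates t hf]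
  · rw [det_partialMapRow_of_not_terminates t hf, mul_zero]

end PartialMaps

/-! ### Rooted forests as terminating partial maps -/

section PartialMapForests

variable {V : Type u} {F : Finset (V × V)}

theorem underlyingGraph_adj {u v : V} :
    (underlyingGraph F).Adj u v ↔ u ≠ v ∧ ((u, v) ∈ F ∨ (v, u) ∈ F) :=
  SimpleGraph.fromRel_adj _ _ _

/-- A height function on a digraph that strictly decreases along edges decreases along directed
walks. -/
theorem height_le_of_directed {α : Type*} [Preorder α] {h : V → α}
    (hF : ∀ u v, (u, v) ∈ F → h v < h u) {u v : V} (p : (underlyingGraph F).Walk u v)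
    (hp : ∀ d ∈ p.darts, (d.fst, d.snd) ∈ F) : h v ≤ h u := by
  induction p with
  | nil => exact le_rfl
  | cons hadj p ih =>
    simp only [SimpleGraph.Walk.darts_cons, List.mem_cons, forall_eq_or_imp] at hp
    exact (ih hp.2).trans (hF _ _ hp.1).le

/-- At a highest vertex of a cycle both cycle edges point outwards, so out-degree at most one makes
its two neighbours on the cycle coincide. -/
theorem underlyingGraph_isAcyclic {α : Type*} [LinearOrder α] {h : V → α}
    (hF : ∀ u v, (u, v) ∈ F → h v < h u)
    (huniq : ∀ u v w, (u, v) ∈ F → (u, w) ∈ F → v = w) : (underlyingGraph F).IsAcyclic := by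
  classical
  intro a c hc
  obtain ⟨u, hu, hmax⟩ := c.support.toFinset.exists_max_image h ⟨a, by simp⟩
  simp only [List.mem_toFinset] at hu hmax
  have hc' := hc.rotate hu
  have key : ∀ w ∈ (c.rotate u hu).support, (underlyingGraph F).Adj u w → (u, w) ∈ F := by
    intro w hw hadj
    rcases (underlyingGraph_adj.1 hadj).2 with h1 | h1
    · exact h1
    · exact absurd (hF _ _ h1) (hmax w (by simpa using hw)).not_gt
  refine hc'.snd_ne_penultimate (huniq u _ _ (key _ ?_ ?_) (key _ ?_ ?_))
  · exact SimpleGraph.Walk.getVert_mem_support _ _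
  · exact SimpleGraph.Walk.adj_snd hc'.not_nil
  · exact SimpleGraph.Walk.getVert_mem_support _ _
  · exact (SimpleGraph.Walk.adj_penultimate hc'.not_nil).symm

/-- Paths in a forest are unique, so it suffices that `q` avoids `u`. Otherwise `q` would start with
the step from `v` to `u`, against asymmetry. -/
theorem directed_path_eq_cons (hasymm : ∀ u v, (u, v) ∈ F → (v, u) ∉ F)
    (hac : (underlyingGraph F).IsAcyclic) {u v r : V} (huv : (u, v) ∈ F)
    (hadj : (underlyingGraph F).Adj u v) (p : (underlyingGraph F).Path u r)
    (q : (underlyingGraph F).Path v r) (hq : ∀ d ∈ q.1.darts, (d.fst, d.snd) ∈ F) :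
    p.1 = SimpleGraph.Walk.cons hadj q.1 := by
  classical
  suffices h : u ∉ q.1.support from
    congrArg Subtype.val ((hac.subsingleton_path u r).elim p ⟨.cons hadj q.1, q.2.cons h⟩)
  intro hu
  have h1 := (hac.subsingleton_path v u).elim ⟨q.1.takeUntil u hu, q.2.takeUntil hu⟩
    (SimpleGraph.Path.singleton hadj.symm)
  have h2 : q.1.takeUntil u hu = .cons hadj.symm .nil := congrArg Subtype.val h1
  refine hasymm u v huv (hq ⟨(v, u), hadj.symm⟩ ?_)
  apply q.1.darts_takeUntil_subset_darts hu
  simp [h2]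

/-- In a rooted forest every vertex has at most one outgoing edge, and the distance to the root
decreases along edges. -/
theorem IsRootedForest.exists_height {k : ℕ} (hF : IsRootedForest k F) :
    ∃ h : V → ℕ, (∀ u v, (u, v) ∈ F → h v < h u) ∧
      ∀ u v w, (u, v) ∈ F → (u, w) ∈ F → v = w := by
  classical
  choose r hr hroot using hF.exists_root
  have hreach : ∀ u, (underlyingGraph F).Reachable u
      (r ((underlyingGraph F).connectedComponentMk u)) := fun u =>
    (SimpleGraph.ConnectedComponent.exact (hr ((underlyingGraph F).connectedComponentMk u))).symm
  choose p hp using fun u => (hroot _ u (hreach u)).exists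
  have hadj : ∀ u v, (u, v) ∈ F → (underlyingGraph F).Adj u v := by
    refine fun u v huv => underlyingGraph_adj.2 ⟨?_, .inl huv⟩
    rintro rfl
    exact hF.asymm u u huv huv
  have key : ∀ u v, (u, v) ∈ F → (p u).1.length = (p v).1.length + 1 ∧ (p u).1.snd = v := by
    intro u v huv
    have hr : r ((underlyingGraph F).connectedComponentMk u) =
        r ((underlyingGraph F).connectedComponentMk v) :=
      congrArg r (SimpleGraph.ConnectedComponent.sound (hadj u v huv).reachable)
    -- The two roots are equal only propositionally; free endpoints allow the substitution.
    have gen : ∀ (a b : V) (P : (underlyingGraph F).Path u a) (Q : (underlyingGraph F).Path v b),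
        a = b → (∀ d ∈ Q.1.darts, (d.fst, d.snd) ∈ F) →
        P.1.length = Q.1.length + 1 ∧ P.1.snd = v := by
      rintro a _ P Q rfl hQ
      rw [directed_path_eq_cons hF.asymm hF.acyclic huv (hadj u v huv) P Q hQ]
      simp
    exact gen _ _ _ _ hr (hp v)
  exact ⟨fun u => (p u).1.length, fun u v huv => by
      have := (key u v huv).1
      dsimp only
      omega,
    fun u v w huv huw => (key u v huv).2.symm.trans (key u w huw).2⟩

variable [Fintype V] [DecidableEq V]

/-- The edges `u → f u` of a partial map `f`. -/
def partialMapEdges (f : V → Option V) : Finset (V × V) := {e | f e.1 = some e.2}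

theorem mem_partialMapEdges {f : V → Option V} {u v : V} :
    (u, v) ∈ partialMapEdges f ↔ f u = some v := by
  simp [partialMapEdges]

theorem partialMapEdges_injective :
    Function.Injective (partialMapEdges : (V → Option V) → Finset (V × V)) := by
  intro f g hfg
  funext u
  ext v
  rw [← mem_partialMapEdges, hfg, mem_partialMapEdges]

theorem IsRootedForest.exists_partialMap {k : ℕ} (hF : IsRootedForest k F) :
    ∃ f, Terminates f ∧ partialMapEdges f = F := by
  classical
  obtain ⟨h, hlt, huniq⟩ := hF.exists_height
  let f : V → Option V := fun u => if h : ∃ v, (u, v) ∈ F then some h.choose else none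
  have hf : ∀ u v, f u = some v ↔ (u, v) ∈ F := by
    intro u v
    by_cases hu : ∃ v, (u, v) ∈ F
    · simp only [f, hu, dite_true, Option.some_inj]
      exact ⟨fun e => e ▸ hu.choose_spec, huniq u _ _ hu.choose_spec⟩
    · simp only [f, hu, dite_false, reduceCtorEq, false_iff]
      exact fun h => hu ⟨v, h⟩
  refine ⟨f, ?_, ?_⟩
  · exact Subrelation.wf (fun {v u} huv => hlt u v ((hf u v).1 huv)) (measure h).wf
  · ext ⟨u, v⟩
    rw [mem_partialMapEdges, hf]

section Terminates

variable {f : V → Option V}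

theorem Terminates.exists_height (hf : Terminates f) :
    ∃ h : V → Ordinal.{u}, ∀ u v, (u, v) ∈ partialMapEdges f → h v < h u := by
  have : IsWellFounded V fun v u => f u = some v := ⟨hf⟩
  exact ⟨IsWellFounded.rank fun v u => f u = some v, fun u v huv =>
    IsWellFounded.rank_lt_of_rel (r := fun v u => f u = some v) (mem_partialMapEdges.1 huv)⟩

theorem Terminates.isAcyclic (hf : Terminates f) : (underlyingGraph (partialMapEdges f)).IsAcyclic := by
  obtain ⟨h, hh⟩ := hf.exists_height
  refine underlyingGraph_isAcyclic hh fun u v w huv huw => ?_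
  rw [mem_partialMapEdges] at huv huw
  exact Option.some_injective _ (huv.symm.trans huw)

theorem Terminates.adj {u v : V} (hf : Terminates f) (huv : f u = some v) :
    (underlyingGraph (partialMapEdges f)).Adj u v := by
  obtain ⟨h, hh⟩ := hf.exists_height
  refine underlyingGraph_adj.2 ⟨?_, .inl (mem_partialMapEdges.2 huv)⟩
  rintro rfl
  exact lt_irrefl _ (hh u u (mem_partialMapEdges.2 huv))

/-- Every orbit of a terminating partial map ends in a point without image. -/
theorem Terminates.exists_end (hf : Terminates f) :
    ∃ ρ : V → V, (∀ u, f (ρ u) = none) ∧ (∀ u, f u = none → ρ u = u) ∧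
      (∀ u v, (underlyingGraph (partialMapEdges f)).Reachable u v → ρ u = ρ v) ∧
      ∀ u, ∃ p : (underlyingGraph (partialMapEdges f)).Walk u (ρ u),
        ∀ d ∈ p.darts, (d.fst, d.snd) ∈ partialMapEdges f := by
  obtain ⟨ρ, hρ⟩ : ∃ ρ : V → V, ∀ u, ρ u = (f u).elim u ρ := by
    let g : ∀ u, (∀ v, f u = some v → V) → V := fun u ih =>
      match h : f u with
      | none => u
      | some v => ih v h
    have hwf : WellFounded fun v u => f u = some v := hf
    refine ⟨hwf.fix g, fun u => ?_⟩
    rw [hwf.fix_eq]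
    dsimp only [g]
    split <;> simp_all
  have hstep : ∀ u v, f u = some v → ρ u = ρ v := fun u v huv => by rw [hρ, huv]; rfl
  have hend : ∀ u, f u = none → ρ u = u := fun u hu => by rw [hρ, hu]; rfl
  refine ⟨ρ, fun u => ?_, hend, ?_, fun u => ?_⟩
  · induction u using WellFounded.induction hf with
    | _ u ih =>
      rcases hu : f u with _ | v
      · rw [hend u hu, hu]
      · rw [hstep u v hu]; exact ih v hu
  · rintro u v ⟨p⟩
    induction p with
    | nil => rfl
    | cons hadj p ih =>
      rw [← ih]
      rcases (underlyingGraph_adj.1 hadj).2 with h | h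
      · exact hstep _ _ (mem_partialMapEdges.1 h)
      · exact (hstep _ _ (mem_partialMapEdges.1 h)).symm
  · induction u using WellFounded.induction hf with
    | _ u ih =>
      rcases hu : f u with _ | v
      · rw [hend u hu]
        exact ⟨.nil, by simp⟩
      · rw [hstep u v hu]
        obtain ⟨p, hp⟩ := ih v hu
        refine ⟨.cons (hf.adj hu) p, ?_⟩
        simp only [SimpleGraph.Walk.darts_cons, List.mem_cons, forall_eq_or_imp]
        exact ⟨mem_partialMapEdges.2 hu, hp⟩

/-- Directed paths never climb, so a point with an image is unreachable from that image, which lies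
lower in the same component. Conversely all orbits in the component of a point without image end
there, and acyclicity gives uniqueness. -/
theorem Terminates.isRoot_iff {r : V} (hf : Terminates f) : IsRoot (partialMapEdges f) r ↔ f r = none := by
  obtain ⟨ρ, hρ, hend, hconst, hwalk⟩ := hf.exists_end
  obtain ⟨h, hh⟩ := hf.exists_height
  constructor
  · intro hr
    rcases hv : f r with _ | v
    · rfl
    · obtain ⟨p, hp⟩ := (hr v (hf.adj hv).reachable.symm).exists
      exact absurd (hh r v (mem_partialMapEdges.2 hv))
        (height_le_of_directed hh p.1 hp).not_gt
  · intro hr u hu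
    have hur : ρ u = r := (hconst u r hu).trans (hend r hr)
    obtain ⟨p, hp⟩ := hwalk u
    subst hur
    exact ⟨p.toPath, fun d hd => hp d (p.darts_toPath_subset_darts hd),
      fun q _ => (hf.isAcyclic.subsingleton_path _ _).elim q _⟩

theorem Terminates.roots_eq (hf : Terminates f) : roots (partialMapEdges f) = ({u | f u = none} : Finset V) := by
  ext r
  simp [roots, hf.isRoot_iff]

theorem Terminates.isRootedForest (hf : Terminates f) :
    IsRootedForest #{u | f u = none} (partialMapEdges f) := by
  obtain ⟨ρ, hρ, hend, hconst, hwalk⟩ := hf.exists_end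
  obtain ⟨h, hh⟩ := hf.exists_height
  refine ⟨fun u v huv hvu => (hh u v huv).not_gt (hh v u hvu), hf.isAcyclic, ?_, fun c => ?_⟩
  · rw [← Fintype.card_subtype, ← Nat.card_eq_fintype_card]
    symm
    -- Each component contains exactly one end point, the common value of `ρ` on it.
    refine Nat.card_congr (Equiv.ofBijective (fun r : {u // f u = none} =>
      (underlyingGraph (partialMapEdges f)).connectedComponentMk r) ⟨?_, ?_⟩)
    · intro r s hrs
      have := hconst _ _ (SimpleGraph.ConnectedComponent.exact hrs)
      rw [hend r r.2, hend s s.2] at this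
      exact Subtype.ext this
    · intro c
      induction c using SimpleGraph.ConnectedComponent.ind with
      | _ u => exact ⟨⟨ρ u, hρ u⟩, SimpleGraph.ConnectedComponent.sound ⟨(hwalk u).choose.reverse⟩⟩
  · induction c using SimpleGraph.ConnectedComponent.ind with
    | _ u => exact ⟨ρ u, SimpleGraph.ConnectedComponent.sound ⟨(hwalk u).choose.reverse⟩,
        hf.isRoot_iff.2 (hρ u)⟩

end Terminates

open Classical in
theorem sum_isRootedForest {M : Type*} [AddCommMonoid M] (k : ℕ) (φ : Finset (V × V) → M) :
    ∑ F with IsRootedForest k F, φ F =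
      ∑ f : V → Option V with Terminates f ∧ #{u | f u = none} = k, φ (partialMapEdges f) := by
  symm
  refine Finset.sum_bij (fun f _ => partialMapEdges f) ?_ ?_ ?_ ?_
  · intro f hf
    simp only [Finset.mem_filter, Finset.mem_univ, true_and] at hf ⊢
    exact hf.2 ▸ hf.1.isRootedForest
  · exact fun f _ g _ h => partialMapEdges_injective h
  · intro F hF
    simp only [Finset.mem_filter, Finset.mem_univ, true_and] at hF
    obtain ⟨f, hf, rfl⟩ := hF.exists_partialMap
    refine ⟨f, ?_, rfl⟩
    simp only [Finset.mem_filter, Finset.mem_univ, true_and]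
    exact ⟨hf, hf.isRootedForest.card_components.symm.trans hF.card_components⟩
  · exact fun _ _ => rfl

theorem prod_partialMapEdges {M : Type*} [CommMonoid M] (f : V → Option V) (w : V → V → M) :
    ∏ e ∈ partialMapEdges f, w e.1 e.2 = ∏ u, (f u).elim 1 (w u) := by
  rw [partialMapEdges, Finset.prod_filter, Fintype.prod_prod_type]
  refine Finset.prod_congr rfl fun u _ => ?_
  rcases hu : f u with _ | v
  · simp [hu]
  · simp [hu, Finset.prod_ite_eq]

end PartialMapForests

/-! ### Trace of the pseudoinverse from the characteristic polynomial -/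

section MoorePenroseTrace

variable {n : Type*} [Fintype n] [DecidableEq n] {M : Matrix n n ℝ} {q : n → ℝ}

theorem moorePenrose_eq_of_isMoorePenroseInverse {X : Matrix n n ℝ}
    (hX : IsMoorePenroseInverse M X) : moorePenrose M = X :=
  (exists_isMoorePenroseInverse M).choose_spec.unique hX

/-- `J = q qᵀ` is an orthogonal projection with `M J = J M = 0`, and `K = M + J` fixes `q` on both
sides. Hence both products of `M` with `K⁻¹ - J` are the symmetric matrix `1 - J`. -/
theorem moorePenrose_eq_inv_sub (hMq : M *ᵥ q = 0) (hqM : q ᵥ* M = 0) (hq : q ⬝ᵥ q = 1)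
    (hdet : (M + vecMulVec q q).det ≠ 0) :
    moorePenrose M = (M + vecMulVec q q)⁻¹ - vecMulVec q q := by
  have hK : IsUnit (M + vecMulVec q q).det := isUnit_iff_ne_zero.2 hdet
  set J := vecMulVec q q with hJ
  set K := M + J with hKdef
  have hMJ : M * J = 0 := by rw [hJ, mul_vecMulVec, hMq, zero_vecMulVec]
  have hJM : J * M = 0 := by rw [hJ, vecMulVec_mul, hqM, vecMulVec_zero]
  have hJJ : J * J = J := by
    rw [hJ, vecMulVec_mul_vecMulVec, hq, one_smul]
  have hJt : Jᵀ = J := transpose_vecMulVec q q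
  have hJK : J * K⁻¹ = J := by
    have : J * K = J := by rw [hKdef, mul_add, hJM, hJJ, zero_add]
    nth_rewrite 1 [← this]
    rw [mul_assoc, mul_nonsing_inv _ hK, mul_one]
  have hKJ : K⁻¹ * J = J := by
    have : K * J = J := by rw [hKdef, add_mul, hMJ, hJJ, zero_add]
    nth_rewrite 1 [← this]
    rw [← mul_assoc, nonsing_inv_mul _ hK, one_mul]
  have hM : M = K - J := by rw [hKdef, add_sub_cancel_right]
  have hleft : M * (K⁻¹ - J) = 1 - J := by
    rw [mul_sub, hMJ, sub_zero, hM, sub_mul, mul_nonsing_inv _ hK, hJK]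
  have hright : (K⁻¹ - J) * M = 1 - J := by
    rw [sub_mul, hJM, sub_zero, hM, mul_sub, nonsing_inv_mul _ hK, hKJ]
  refine moorePenrose_eq_of_isMoorePenroseInverse ⟨?_, ?_, ?_, ?_⟩
  · rw [hleft, sub_mul, hJM, one_mul, sub_zero]
  · rw [hright, sub_mul, one_mul, mul_sub, hJK, hJJ, sub_self, sub_zero]
  · rw [hleft, transpose_sub, transpose_one, hJt]
  · rw [hright, transpose_sub, transpose_one, hJt]

open Polynomial in
-- Since `M J = 0` for `J = q qᵀ`, `(X + M)(X + J) = X (X + M + J)`; take determinants and cancel a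
-- power of `X`.
theorem X_mul_det_add_vecMulVec [Nonempty n] (hMq : M *ᵥ q = 0) (hq : q ⬝ᵥ q = 1) :
    X * ((X : ℝ[X]) • 1 + (M + vecMulVec q q).map C).det =
      (X + 1) * ((X : ℝ[X]) • 1 + M.map C).det := by
  have hJ : ((X : ℝ[X]) • 1 + (vecMulVec q q).map C).det =
      X ^ (Fintype.card n - 1) * (X + 1) := by
    -- The sign turns `det (X - A)` into `det (X + q qᵀ)`.
    have h := charpoly_vecMulVec (-q) q
    rw [neg_dotProduct, hq, Matrix.charpoly, charmatrix] at h
    have h1 : (scalar n) (X : ℝ[X]) - (C : ℝ →+* ℝ[X]).mapMatrix (vecMulVec (-q) q) =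
        (X : ℝ[X]) • 1 + (vecMulVec q q).map C := by
      ext i j
      simp [vecMulVec_apply, Matrix.one_apply, Matrix.diagonal_apply]
    rw [h1] at h
    rw [h]
    obtain ⟨m, hm⟩ := Nat.exists_eq_succ_of_ne_zero (Fintype.card_ne_zero (α := n))
    rw [hm]
    simp
    ring
  have hmul : ((X : ℝ[X]) • 1 + M.map C) * ((X : ℝ[X]) • 1 + (vecMulVec q q).map C) =
      (X : ℝ[X]) • ((X : ℝ[X]) • 1 + (M + vecMulVec q q).map C) := by
    have h0 : M.map (C : ℝ → ℝ[X]) * (vecMulVec q q).map (C : ℝ → ℝ[X]) = 0 := by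
      rw [← Matrix.map_mul, mul_vecMulVec, hMq, zero_vecMulVec]
      ext i j; simp
    rw [Matrix.map_add _ (fun a b => C_add), add_mul, mul_add, mul_add, h0]
    simp only [smul_mul_assoc, mul_smul_comm, one_mul, mul_one, smul_add]
    abel
  have hdet := congrArg Matrix.det hmul
  rw [det_mul, hJ, det_smul] at hdet
  obtain ⟨m, hm⟩ := Nat.exists_eq_succ_of_ne_zero (Fintype.card_ne_zero (α := n))
  rw [hm] at hdet
  simp only [Nat.succ_eq_add_one, Nat.add_sub_cancel] at hdet
  refine mul_left_cancel₀ (pow_ne_zero m X_ne_zero) ?_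
  linear_combination -hdet

open Polynomial in
/-- The trace of the pseudoinverse of a matrix `M` with a common simple left and right null vector
is a quotient of coefficients of `det (X + M)`. -/
theorem trace_moorePenrose [Nonempty n] (hMq : M *ᵥ q = 0) (hqM : q ᵥ* M = 0) (hq : q ⬝ᵥ q = 1)
    (hdet : (M + vecMulVec q q).det ≠ 0) :
    (moorePenrose M).trace = ((X : ℝ[X]) • 1 + M.map C).det.coeff 2 /
      ((X : ℝ[X]) • 1 + M.map C).det.coeff 1 := by
  have hJ : (vecMulVec q q).trace = 1 := by rw [trace_vecMulVec, hq]
  rw [moorePenrose_eq_inv_sub hMq hqM hq hdet, trace_sub, hJ]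
  have hX := X_mul_det_add_vecMulVec hMq hq
  set p := ((X : ℝ[X]) • 1 + M.map C).det
  set K := M + vecMulVec q q
  -- The second factor begins `1 + tr(K⁻¹) X`. Coefficients 1 and 2 of `hX` then give `det K = p₁`
  -- and `det K · tr K⁻¹ = p₁ + p₂`.
  have hK : ((X : ℝ[X]) • 1 + K.map C).det = C K.det * (1 + (X : ℝ[X]) • (K⁻¹).map C).det := by
    rw [RingHom.map_det, RingHom.mapMatrix_apply, ← det_mul, mul_add, mul_one, mul_smul_comm,
      ← Matrix.map_mul, mul_nonsing_inv _ (isUnit_iff_ne_zero.2 hdet), add_comm,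
      Matrix.map_one _ C_0 C_1]
  have h0 : p.coeff 0 = 0 := by
    have := congrArg (fun f => f.coeff 0) hX
    simpa [add_mul] using this.symm
  have h1 : K.det = p.coeff 1 := by
    have := congrArg (fun f => f.coeff 1) hX
    simp only [add_mul, one_mul, coeff_add, hK, coeff_X_mul, coeff_C_mul, h0, zero_add] at this
    rw [← this, coeff_zero_eq_eval_zero]
    simp [eval_det_add_X_smul]
  have h2 : K.det * (K⁻¹).trace = p.coeff 1 + p.coeff 2 := by
    have := congrArg (fun f => f.coeff 2) hX
    simpa only [add_mul, one_mul, coeff_add, hK, coeff_X_mul, coeff_C_mul,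
      coeff_det_one_add_X_smul_one] using this
  rw [← h1, eq_div_iff hdet, sub_mul, mul_comm, h2, h1]
  ring

end MoorePenroseTrace

/-! ### The random walk, its stationary distribution and the normalized Laplacian -/

namespace WeightedDigraph

variable {V : Type*} [Fintype V] {Γ : WeightedDigraph V}

theorem deg_pos [Nontrivial V] (hΓ : Γ.StronglyConnected) (u : V) : 0 < Γ.deg u := by
  obtain ⟨v, hv⟩ := exists_ne u
  rcases (hΓ u v).cases_head with h | ⟨w, hw, -⟩
  · exact absurd h.symm hv
  · exact Finset.sum_pos' (fun _ _ => Γ.weight_nonneg _ _) ⟨w, Finset.mem_univ w, hw.2⟩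

open Classical in
-- A forest using a non-edge of `Γ` has weight zero.
theorem sum_rootedForests (k : ℕ) (φ : Finset (V × V) → ℝ) :
    ∑ F ∈ Γ.rootedForests k, φ F * Γ.forestWeight F =
      ∑ F with IsRootedForest k F, φ F * Γ.forestWeight F := by
  refine Finset.sum_subset (fun F hF => ?_) fun F hF hF' => ?_
  · rw [rootedForests, Finset.mem_filter] at hF
    simpa using hF.2
  · rw [rootedForests, Finset.mem_filter, Finset.mem_powerset] at hF'
    have : ¬ F ⊆ Γ.edges := fun h => hF' ⟨h, (Finset.mem_filter.1 hF).2⟩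
    obtain ⟨e, he, he'⟩ := Finset.not_subset.1 this
    rw [forestWeight, Finset.prod_eq_zero he, mul_zero]
    exact Γ.weight_eq_zero _ _ (by simpa [edges] using he')

variable [DecidableEq V]

theorem transitionMatrix_apply (hd : ∀ u, 0 < Γ.deg u) (u v : V) :
    Γ.transitionMatrix u v = (Γ.deg u)⁻¹ * Γ.weight u v := by
  have : (Matrix.diagonal Γ.deg)⁻¹ = Matrix.diagonal fun u => (Γ.deg u)⁻¹ := by
    refine Matrix.inv_eq_right_inv ?_
    rw [diagonal_mul_diagonal, ← diagonal_one]
    exact congrArg _ (funext fun u => mul_inv_cancel₀ (hd u).ne')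
  rw [transitionMatrix, this, diagonal_mul, adjMatrix, Matrix.of_apply]

theorem transitionMatrix_nonneg (hd : ∀ u, 0 < Γ.deg u) (u v : V) :
    0 ≤ Γ.transitionMatrix u v := by
  rw [transitionMatrix_apply hd]
  exact mul_nonneg (inv_nonneg.2 (hd u).le) (Γ.weight_nonneg u v)

theorem transitionMatrix_pos (hd : ∀ u, 0 < Γ.deg u) {u v : V} (huv : 0 < Γ.weight u v) :
    0 < Γ.transitionMatrix u v := by
  rw [transitionMatrix_apply hd]
  exact mul_pos (inv_pos.2 (hd u)) huv

theorem sum_transitionMatrix (hd : ∀ u, 0 < Γ.deg u) (u : V) :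
    ∑ v, Γ.transitionMatrix u v = 1 := by
  simp_rw [transitionMatrix_apply hd, ← Finset.mul_sum]
  exact inv_mul_cancel₀ (hd u).ne'

/-- Harmonic functions on a strongly connected digraph are constant. -/
theorem eq_of_mulVec_transitionMatrix_eq [Nonempty V] (hΓ : Γ.StronglyConnected)
    (hd : ∀ u, 0 < Γ.deg u) {y : V → ℝ} (hy : Γ.transitionMatrix *ᵥ y = y) (u v : V) :
    y u = y v := by
  obtain ⟨m, -, hm⟩ := Finset.univ.exists_max_image y Finset.univ_nonempty
  suffices h : ∀ w, y w = y m from (h u).trans (h v).symm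
  intro w
  induction hΓ m w with
  | refl => rfl
  | @tail a b _ hab ih =>
    by_contra hne
    have hlt : y b < y a := ih ▸ lt_of_le_of_ne (hm b (Finset.mem_univ b)) hne
    -- Maximum principle: a smaller value at the successor `b` pulls the average at `a` strictly
    -- below the maximum `y a`.
    have : ∑ v, Γ.transitionMatrix a v * y v < ∑ v, Γ.transitionMatrix a v * y a :=
      Finset.sum_lt_sum (fun v _ => mul_le_mul_of_nonneg_left
        (ih ▸ hm v (Finset.mem_univ v)) (transitionMatrix_nonneg hd a v))
        ⟨b, Finset.mem_univ b, mul_lt_mul_of_pos_left hlt (transitionMatrix_pos hd hab.2)⟩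
    rw [← Finset.sum_mul, sum_transitionMatrix hd, one_mul] at this
    exact this.ne (congrFun hy a)

/-- `I - P` is singular, so `x P = x` for some `x ≠ 0`. Then `|x| ≤ |x| P` entrywise with equal
totals, which forces equality; positivity spreads along edges. -/
theorem exists_isStationary [Nonempty V] (hΓ : Γ.StronglyConnected) (hd : ∀ u, 0 < Γ.deg u) :
    ∃ p, Γ.IsStationary p := by
  have hdet : (1 - Γ.transitionMatrix).det = 0 := by
    refine Matrix.exists_mulVec_eq_zero_iff.1 ⟨1, one_ne_zero, ?_⟩
    rw [sub_mulVec, one_mulVec, sub_eq_zero]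
    funext u
    simpa [mulVec, dotProduct] using (sum_transitionMatrix hd u).symm
  obtain ⟨x, hx0, hx⟩ := Matrix.exists_vecMul_eq_zero_iff.2 hdet
  rw [vecMul_sub, vecMul_one, sub_eq_zero] at hx
  have hle : ∀ v ∈ Finset.univ, |x v| ≤ ∑ u, |x u| * Γ.transitionMatrix u v := by
    intro v _
    conv_lhs => rw [hx]
    refine (Finset.abs_sum_le_sum_abs _ _).trans_eq (Finset.sum_congr rfl fun u _ => ?_)
    rw [abs_mul, abs_of_nonneg (transitionMatrix_nonneg hd u v)]
  have hsum : ∑ v, |x v| = ∑ v, ∑ u, |x u| * Γ.transitionMatrix u v := by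
    rw [Finset.sum_comm]
    simp_rw [← Finset.mul_sum, sum_transitionMatrix hd, mul_one]
  have habs : ∀ v, |x v| = ∑ u, |x u| * Γ.transitionMatrix u v := fun v =>
    (Finset.sum_eq_sum_iff_of_le hle).1 hsum v (Finset.mem_univ v)
  obtain ⟨a, ha⟩ := Function.ne_iff.1 hx0
  have hpos : ∀ v, 0 < |x v| := by
    intro v
    induction hΓ a v with
    | refl => exact abs_pos.2 ha
    | @tail b c _ hbc ih =>
      rw [habs c]
      exact Finset.sum_pos' (fun u _ => mul_nonneg (abs_nonneg _) (transitionMatrix_nonneg hd u c))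
        ⟨b, Finset.mem_univ b, mul_pos ih (transitionMatrix_pos hd hbc.2)⟩
  have hS : 0 < ∑ v, |x v| := Finset.sum_pos (fun v _ => hpos v) Finset.univ_nonempty
  refine ⟨(∑ v, |x v|)⁻¹ • fun v => |x v|, fun u => mul_pos (inv_pos.2 hS) (hpos u), ?_, ?_⟩
  · simp_rw [Pi.smul_apply, smul_eq_mul, ← Finset.mul_sum]
    exact inv_mul_cancel₀ hS.ne'
  · rw [smul_vecMul]
    exact congrArg _ (funext fun v => (habs v).symm)

theorem isStationary_stationary [Nonempty V] (hΓ : Γ.StronglyConnected)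
    (hd : ∀ u, 0 < Γ.deg u) : Γ.IsStationary Γ.stationary := by
  have h := exists_isStationary hΓ hd
  rw [stationary, dif_pos h]
  exact h.choose_spec

theorem diagonal_sqrt_mul_inv (hπ : Γ.IsStationary Γ.stationary) :
    Matrix.diagonal (fun u => √(Γ.stationary u)) * Matrix.diagonal (fun u => (√(Γ.stationary u))⁻¹)
      = 1 := by
  rw [diagonal_mul_diagonal, ← diagonal_one]
  exact congrArg _ (funext fun u => mul_inv_cancel₀ (Real.sqrt_pos.2 (hπ.pos u)).ne')

theorem normalizedLaplacian_mulVec_eq_zero_iff (hπ : Γ.IsStationary Γ.stationary) {x : V → ℝ} :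
    Γ.normalizedLaplacian *ᵥ x = 0 ↔
      Γ.transitionMatrix *ᵥ (fun u => (√(Γ.stationary u))⁻¹ * x u) =
        fun u => (√(Γ.stationary u))⁻¹ * x u := by
  have hdx : Matrix.diagonal (fun u => (√(Γ.stationary u))⁻¹) *ᵥ x =
      fun u => (√(Γ.stationary u))⁻¹ * x u := funext fun u => mulVec_diagonal _ _ _
  rw [normalizedLaplacian, ← mulVec_mulVec, ← mulVec_mulVec, hdx, sub_mulVec, one_mulVec, eq_comm,
    ← sub_eq_zero (a := Γ.transitionMatrix *ᵥ _), funext_iff, funext_iff]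
  refine forall_congr' fun u => ?_
  rw [mulVec_diagonal, Pi.zero_apply, zero_eq_mul, Pi.sub_apply, Pi.sub_apply, sub_eq_zero,
    sub_eq_zero, or_iff_right (Real.sqrt_pos.2 (hπ.pos u)).ne', eq_comm]

theorem vecMul_normalizedLaplacian (hπ : Γ.IsStationary Γ.stationary) :
    (fun u => √(Γ.stationary u)) ᵥ* Γ.normalizedLaplacian = 0 := by
  have : (fun u => √(Γ.stationary u)) ᵥ* Matrix.diagonal (fun u => √(Γ.stationary u)) =
      Γ.stationary := by
    funext u
    rw [vecMul_diagonal, Real.mul_self_sqrt (hπ.pos u).le]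
  rw [normalizedLaplacian, ← vecMul_vecMul, ← vecMul_vecMul, this, vecMul_sub, vecMul_one,
    hπ.vecMul_eq, sub_self, zero_vecMul]

theorem sqrt_stationary_dotProduct_self (hπ : Γ.IsStationary Γ.stationary) :
    (fun u => √(Γ.stationary u)) ⬝ᵥ (fun u => √(Γ.stationary u)) = 1 := by
  rw [dotProduct, ← hπ.sum_eq_one]
  exact Finset.sum_congr rfl fun u _ => Real.mul_self_sqrt (hπ.pos u).le

theorem normalizedLaplacian_mulVec_sqrt_stationary (hd : ∀ u, 0 < Γ.deg u)
    (hπ : Γ.IsStationary Γ.stationary) :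
    Γ.normalizedLaplacian *ᵥ (fun u => √(Γ.stationary u)) = 0 := by
  rw [normalizedLaplacian_mulVec_eq_zero_iff hπ]
  have : (fun u => (√(Γ.stationary u))⁻¹ * √(Γ.stationary u)) = 1 :=
    funext fun u => inv_mul_cancel₀ (Real.sqrt_pos.2 (hπ.pos u)).ne'
  rw [this]
  funext u
  simpa [mulVec, dotProduct] using sum_transitionMatrix hd u

/-- Pairing a null vector `x` with `q` gives `q · x = 0`, so the Laplacian kills `x`. Then `Π^{-1/2}
x` is harmonic, hence constant, so `x` is a multiple of `q` orthogonal to `q`. -/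
theorem det_normalizedLaplacian_add_ne_zero [Nonempty V] (hΓ : Γ.StronglyConnected)
    (hd : ∀ u, 0 < Γ.deg u) (hπ : Γ.IsStationary Γ.stationary) :
    (Γ.normalizedLaplacian +
      vecMulVec (fun u => √(Γ.stationary u)) (fun u => √(Γ.stationary u))).det ≠ 0 := by
  set q := fun u => √(Γ.stationary u) with hq
  intro h0
  obtain ⟨x, hx0, hx⟩ := Matrix.exists_mulVec_eq_zero_iff.2 h0
  have hqx : q ⬝ᵥ x = 0 := by
    have := congrArg (q ⬝ᵥ ·) hx
    rw [hq] at this ⊢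
    simpa only [dotProduct_mulVec, vecMul_add, vecMul_normalizedLaplacian hπ, zero_add,
      vecMul_vecMulVec, sqrt_stationary_dotProduct_self hπ, one_smul, dotProduct_zero] using this
  rw [add_mulVec, vecMulVec_mulVec, hqx] at hx
  simp only [MulOpposite.op_zero, zero_smul, add_zero] at hx
  rw [normalizedLaplacian_mulVec_eq_zero_iff hπ] at hx
  have hconst := eq_of_mulVec_transitionMatrix_eq hΓ hd hx
  obtain ⟨a⟩ := ‹Nonempty V›
  have hxq : x = ((√(Γ.stationary a))⁻¹ * x a) • q := by
    funext u
    rw [Pi.smul_apply, smul_eq_mul, hconst a u, hq]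
    field_simp [(Real.sqrt_pos.2 (hπ.pos u)).ne']
  rw [hxq, dotProduct_smul, sqrt_stationary_dotProduct_self hπ, smul_eq_mul, mul_one] at hqx
  exact hx0 (by rw [hxq, hqx, zero_smul])

open Polynomial in
theorem det_X_add_normalizedLaplacian (hπ : Γ.IsStationary Γ.stationary) :
    ((X : ℝ[X]) • 1 + Γ.normalizedLaplacian.map C).det =
      ((X : ℝ[X]) • 1 + (1 - Γ.transitionMatrix).map C).det := by
  have h1 := diagonal_sqrt_mul_inv hπ
  rw [normalizedLaplacian]
  set S := Matrix.diagonal (fun u => √(Γ.stationary u))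
  set T := Matrix.diagonal (fun u => (√(Γ.stationary u))⁻¹)
  have h2 : S.map (C : ℝ → ℝ[X]) * T.map C = 1 := by
    rw [← Matrix.map_mul, h1, Matrix.map_one _ C_0 C_1]
  have h3 : (X : ℝ[X]) • 1 + (S * (1 - Γ.transitionMatrix) * T).map C =
      S.map C * ((X : ℝ[X]) • 1 + (1 - Γ.transitionMatrix).map C) * T.map C := by
    rw [Matrix.map_mul, Matrix.map_mul, mul_add, add_mul, mul_smul_comm, mul_one, smul_mul_assoc,
      h2]
  rw [h3, det_mul, det_mul, mul_right_comm, ← det_mul, h2, det_one, one_mul]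

open Polynomial in
theorem coeff_det_X_add (hd : ∀ u, 0 < Γ.deg u) (k : ℕ) :
    (∏ u, Γ.deg u) * ((X : ℝ[X]) • 1 + (1 - Γ.transitionMatrix).map C).det.coeff k =
      ∑ F ∈ Γ.rootedForests k, (∏ r ∈ roots F, Γ.deg r) * Γ.forestWeight F := by
  classical
  -- Rows of `P` sum to 1, so `I - P` is the Laplacian of the weights `P`.
  have hL : (1 - Γ.transitionMatrix).map (C : ℝ → ℝ[X]) =
      Matrix.diagonal (fun u => ∑ v, Γ.transitionMatrix.map (C : ℝ → ℝ[X]) u v) -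
        Γ.transitionMatrix.map C := by
    have h1 : (fun u => ∑ v, Γ.transitionMatrix.map (C : ℝ → ℝ[X]) u v) = 1 := by
      funext u
      simp_rw [Matrix.map_apply, ← map_sum, sum_transitionMatrix hd, C_1, Pi.one_apply]
    rw [h1, Matrix.map_sub _ (fun a b => C_sub), Matrix.map_one _ C_0 C_1]
    exact congrArg (· - _) diagonal_one.symm
  have hC : ∀ f : V → Option V, ∏ u, (f u).elim 1 (Γ.transitionMatrix.map (C : ℝ → ℝ[X]) u) =
      C (∏ u, (f u).elim 1 (Γ.transitionMatrix u)) := by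
    intro f
    rw [map_prod]
    refine Finset.prod_congr rfl fun u _ => ?_
    rcases f u with _ | v <;> simp
  have hdeg : ∀ f : V → Option V, (∏ u, Γ.deg u) * ∏ u, (f u).elim 1 (Γ.transitionMatrix u) =
      (∏ u with f u = none, Γ.deg u) * ∏ u, (f u).elim 1 (Γ.weight u) := by
    intro f
    rw [Finset.prod_filter, ← Finset.prod_mul_distrib, ← Finset.prod_mul_distrib]
    refine Finset.prod_congr rfl fun u _ => ?_
    rcases hu : f u with _ | v
    · simp
    · simp [transitionMatrix_apply hd, mul_inv_cancel_left₀ (hd u).ne']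
  rw [sum_rootedForests k, sum_isRootedForest k, hL, det_smul_one_add_laplacian, finsetSum_coeff,
    ← Finset.filter_filter, Finset.sum_filter (fun f : V → Option V => #{u | f u = none} = k),
    Finset.mul_sum]
  refine Finset.sum_congr rfl fun f hf => ?_
  rw [hC, coeff_C_mul_X_pow, mul_ite, mul_zero, hdeg, forestWeight, prod_partialMapEdges,
    (Finset.mem_filter.1 hf).2.roots_eq]
  simp only [eq_comm]

end WeightedDigraph

theorem corollary4 {V : Type*} [Fintype V] [DecidableEq V] [Nontrivial V]
    (Γ : WeightedDigraph V) (hΓ : Γ.StronglyConnected) :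
    Γ.normalizedGreen.trace =
      1 / (∑ w, Γ.deg w * Γ.treeWeight w) *
        ∑ F ∈ Γ.rootedForests 2, (∏ r ∈ roots F, Γ.deg r) * Γ.forestWeight F := by
  classical
  have hd := WeightedDigraph.deg_pos hΓ
  have hπ := WeightedDigraph.isStationary_stationary hΓ hd
  -- A tree has a single root, so exchanging the sums counts each tree once, with the degree of its
  -- root.
  have htree : ∑ w, Γ.deg w * Γ.treeWeight w =
      ∑ F ∈ Γ.rootedForests 1, (∏ r ∈ roots F, Γ.deg r) * Γ.forestWeight F := by
    simp_rw [WeightedDigraph.treeWeight, Finset.mul_sum, Finset.sum_filter]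
    rw [Finset.sum_comm]
    refine Finset.sum_congr rfl fun F hF => ?_
    obtain ⟨f, hf, rfl⟩ := (Finset.mem_filter.1 hF).2.exists_partialMap
    have hcard : #(roots (partialMapEdges f)) = 1 := by
      rw [hf.roots_eq]
      exact hf.isRootedForest.card_components.symm.trans (Finset.mem_filter.1 hF).2.card_components
    obtain ⟨r, hr⟩ := Finset.card_eq_one.1 hcard
    rw [← Finset.sum_filter]
    change ∑ w ∈ roots (partialMapEdges f), _ = _
    rw [hr, Finset.sum_singleton, Finset.prod_singleton]
  rw [htree, ← WeightedDigraph.coeff_det_X_add hd, ← WeightedDigraph.coeff_det_X_add hd,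
    WeightedDigraph.normalizedGreen, trace_moorePenrose
      (WeightedDigraph.normalizedLaplacian_mulVec_sqrt_stationary hd hπ)
      (WeightedDigraph.vecMul_normalizedLaplacian hπ)
      (WeightedDigraph.sqrt_stationary_dotProduct_self hπ)
      (WeightedDigraph.det_normalizedLaplacian_add_ne_zero hΓ hd hπ),
    WeightedDigraph.det_X_add_normalizedLaplacian hπ, one_div_mul_eq_div,
    mul_div_mul_left _ _ (Finset.prod_ne_zero_iff.2 fun u _ => (hd u).ne')]
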